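/- **Setting.** Let $C_2\subseteq C_1\subseteq\mathbb F_q^n$ be linear codes, let $\vec b_1,\dots,\vec b_{k_2}$ be a basis of $C_2$ and $\vec b_1,\dots,\vec b_{k_2+\ell}$ a basis of $C_1$. In the corresponding linear ramp secret sharing scheme a secret $\vec x\in\mathbb F_q^\ell$ is encoded, with uniformly random $\vec a\in\mathbb F_q^{k_2}$, as $\vec c=\sum_{i\le k_2}a_i\vec b_i+\sum_{i\le\ell}x_i\vec b_{k_2+i}$, and $c_p$ is the share of participant $p$. If $N$ secrets are compatible with the shares of a set $A$ of participants, then $A$ holds $\ell-\log_q N$ $q$-bits of information. The set $A$ is *non-$i$-qualifying* if it cannot recover $i$ $q$-bits of information, and *maximum non-$i$-qualifying* if it is of largest size among the non-$i$-qualifying sets. The reconstruction number $r_i$ is the smallest $r$ such that any set of $r$ participants can recover $i$ $q$-bits. The relative generalized Hamming weight $M_t(C_1,C_2)$ is the minimum of $\#\mathrm{Supp}(W)$ over the subspaces $W\subseteq C_1$ with $W\cap C_2=\{\vec 0\}$ and $\dim W=t$, where $\mathrm{Supp}(W)$ is the set of coordinates in which some word of $W$ is non-zero. Let $S_1,\dots,S_m\subseteq\mathbb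 F_q$ with $s_i=\#S_i$, and let $0\le v_i<j_i<s_i$ be integers. The participants are the points of $S_1\times\cdots\times S_m$. Put $\Delta=\{X_1^{i_1}\cdots X_m^{i_m}\mid 0\le i_t<s_t\}$, $L_1=\{X_1^{i_1}\cdots X_m^{i_m}\mid 0\le i_t\le j_t\}$, $\Box=\{X_1^{i_1}\cdots X_m^{i_m}\mid v_t\le i_t\le j_t\}$, $L_2=L_1\setminus\Box$, and $\Diamond=\{M\in L_1\mid X_1^{v_1}\cdots X_m^{v_m}\preceq M\}$, where $\prec$ is the lexicographic ordering with $X_m\prec\cdots\prec X_1$. For a set $L$ of monomials let $C(L)$ be the span of the evaluation vectors of its members on $S_1\times\cdots\times S_m$; for a set $K$ of monomials let $D(K)$ be the number of members of $\Delta$ that are divisible by some member of $K$. The scheme defined from $C_2=C(L_2)\subseteq C(L_1)=C_1$ is called *considerate* if for every $i=1,\dots,\#\Box$, among the sets $K\subseteq\Diamond$ of size $i$ the minimum of $D(K)$ is attained by some $K'\subseteq\Box$. **Theorem.** Consider a considerate scheme with $m\ge 2$ variables and $s=s_1=\cdots=s_m$, $v=v_1=\cdots=v_m$, $j=j_1=\cdots=j_m$.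 There are $s^m$ participants, and the secret is of size $\ell=(j-v+1)^m$. Let $a,b\ge 0$ with $a+b=m$ and $e=z^a(z-1)^b$, where $1\le z\le j-v+1$ if $b=0$ and $2\le z\le j-v+1$ if $b>0$. Then $$M_e(C_1,C_2)=(s-j-1+z)^a(s-j-2+z)^b,$$ $$r_{\ell-e+1}=s^m-(s-j-1+z)^a(s-j-2+z)^b+1.$$ Moreover, let $T_i\subseteq S_i$ ($i=1,\dots,m$) be sets of which $a$ have size $s-j-1+z$ and the remaining $b$ have size $s-j-2+z$. Then the set $(S_1\times\cdots\times S_m)\setminus(T_1\times\cdots\times T_m)$ of participants holds at most $\ell-e$ $q$-bits of information, and it is a maximum non-$(\ell-e+1)$-qualifying set. -/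

import Mathlib

/-- A linear ramp secret sharing scheme in its coset form: nested codes `C₂ ⊆ C₁ ⊆ F^ι`
(the participants are the elements of `ι`), a basis `b₁, …, b_{k₂}` of `C₂`, and an extension of
it by `ℓ` further vectors to a basis of `C₁`. -/
structure CosetScheme {F ι : Type*} [Field F] (C₂ C₁ : Submodule F (ι → F)) where
  k₂ : ℕ
  ℓ : ℕ
  basis₂ : Module.Basis (Fin k₂) F C₂
  basis₁ : Module.Basis (Fin k₂ ⊕ Fin ℓ) F C₁
  basis₁_inl : ∀ i, (basis₁ (Sum.inl i) : ι → F) = basis₂ i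

namespace CosetScheme

variable {F ι : Type*} [Field F] {C₂ C₁ : Submodule F (ι → F)}

/-- The share vector of the secret `x` when the randomness is `a`. -/
noncomputable def encode (P : CosetScheme C₂ C₁) (a : Fin P.k₂ → F) (x : Fin P.ℓ → F) : ι → F :=
  ∑ i, a i • (P.basis₁ (Sum.inl i) : ι → F) + ∑ i, x i • (P.basis₁ (Sum.inr i) : ι → F)

/-- The secrets that are compatible with the shares `c p`, `p ∈ A`. -/
noncomputable def possibleSecrets (P : CosetScheme C₂ C₁) (A : Finset ι) (c : ι → F) : Set (Fin P.ℓ → F) :=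
  {x | ∃ a : Fin P.k₂ → F, ∀ p ∈ A, P.encode a x p = c p}

/-- The amount of information, in `q`-bits (`q = #F`), that the participants in `A` hold about
the secret when the share vector is `c`: the length `ℓ` of the secret minus the uncertainty, which
is the logarithm to base `q` of the number of secrets that are still possible. -/
noncomputable def information [Fintype F] (P : CosetScheme C₂ C₁) (A : Finset ι) (c : ι → F) : ℝ :=
  P.ℓ - Real.logb (Fintype.card F) ((P.possibleSecrets A c).ncard)

/-- The set `A` of participants can recover `i` `q`-bits of information, for all share vectors
that can be dealt. -/
def CanRecover [Fintype F] (P : CosetScheme C₂ C₁) (A : Finset ι) (i : ℕ) : Prop :=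
  ∀ (a : Fin P.k₂ → F) (x : Fin P.ℓ → F), (i : ℝ) ≤ P.information A (P.encode a x)

/-- `A` is non-`i`-qualifying. -/
def NonQualifying [Fintype F] (P : CosetScheme C₂ C₁) (i : ℕ) (A : Finset ι) : Prop :=
  ¬ P.CanRecover A i

/-- `A` is maximum non-`i`-qualifying: of largest size among the non-`i`-qualifying sets. -/
def MaximumNonQualifying [Fintype F] (P : CosetScheme C₂ C₁) (i : ℕ) (A : Finset ι) : Prop :=
  P.NonQualifying i A ∧ ∀ B : Finset ι, P.NonQualifying i B → B.card ≤ A.card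

/-- `r` is the `i`-th reconstruction number `r_i`: the smallest number such that any set of `r`
participants can recover `i` `q`-bits of information. -/
def IsReconstructionNumber [Fintype F] (P : CosetScheme C₂ C₁) (i r : ℕ) : Prop :=
  IsLeast {r : ℕ | ∀ A : Finset ι, A.card = r → P.CanRecover A i} r

end CosetScheme

/-- The support of a space of words. -/
def codeSupport {F ι : Type*} [Field F] (W : Submodule F (ι → F)) : Set ι :=
  {p | ∃ c ∈ W, c p ≠ 0}

/-- `w` is the `t`-th relative generalized Hamming weight `M_t(C₁, C₂)`. -/
def IsRelGenHammingWeight {F ι : Type*} [Field F] (C₁ C₂ : Submodule F (ι → F)) (t w : ℕ) : Prop :=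
  IsLeast {w : ℕ | ∃ W : Submodule F (ι → F),
    W ≤ C₁ ∧ W ⊓ C₂ = ⊥ ∧ Module.finrank F W = t ∧ (codeSupport W).ncard = w} w

namespace MonomialCartesian

variable {m : ℕ} {F : Type*} [Field F]

/-- The point set `S₁ × ⋯ × S_m`, which is the set of participants. -/
abbrev Point (S : Fin m → Finset F) : Type _ := ∀ i, {x : F // x ∈ S i}

/-- The evaluation map. (It is constant modulo the vanishing ideal of the point set.) -/
noncomputable def ev (S : Fin m → Finset F) : MvPolynomial (Fin m) F →ₗ[F] (Point S → F) where
  toFun f := fun p => MvPolynomial.eval (fun i => (p i : F)) f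
  map_add' f g := by ext p; simp
  map_smul' c f := by ext p; simp [MvPolynomial.smul_eval]

/-- The monomial `X₁^{e₁} ⋯ X_m^{e_m}`. Sets of monomials are given as sets of exponents. -/
noncomputable def mono (F : Type*) [Field F] (e : Fin m → ℕ) : MvPolynomial (Fin m) F :=
  ∏ i, MvPolynomial.X i ^ e i

/-- The code `C(L)`. -/
noncomputable def code (S : Fin m → Finset F) (L : Finset (Fin m → ℕ)) :
    Submodule F (Point S → F) :=
  (Submodule.span F (mono F '' (L : Set (Fin m → ℕ)))).map (ev S)

/-- `Δ(s₁, …, s_m)` with `s_i = #S_i`. -/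
def delta (S : Fin m → Finset F) : Finset (Fin m → ℕ) :=
  Fintype.piFinset fun i => Finset.range (S i).card

open Classical in
/-- `D(K)`, the number of monomials in `Δ(s₁, …, s_m)` that are divisible by some member of `K`. -/
noncomputable def D (S : Fin m → Finset F) (K : Finset (Fin m → ℕ)) : ℕ :=
  ((delta S).filter fun N => ∃ M ∈ K, M ≤ N).card

/-- `L₁`, the monomials with all exponents `i_t ≤ j_t`. -/
def L₁ (j : Fin m → ℕ) : Finset (Fin m → ℕ) := Finset.Icc 0 j

/-- `□`, the monomials with all exponents `v_t ≤ i_t ≤ j_t`. -/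
def box (v j : Fin m → ℕ) : Finset (Fin m → ℕ) := Finset.Icc v j

/-- `L₂ = L₁ \ □`. -/
def L₂ (v j : Fin m → ℕ) : Finset (Fin m → ℕ) := L₁ j \ box v j

open Classical in
/-- `◇`, the members of `L₁` that are at least `X₁^{v₁} ⋯ X_m^{v_m}` in the lexicographic ordering
with `X_m ≺ ⋯ ≺ X₁`. -/
noncomputable def diamond (v j : Fin m → ℕ) : Finset (Fin m → ℕ) :=
  (L₁ j).filter fun M => toLex v ≤ toLex M

/-- The scheme with codes `C(L₂) ⊆ C(L₁)` given by `S`, `v`, `j` is considerate. -/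
def Considerate (S : Fin m → Finset F) (v j : Fin m → ℕ) : Prop :=
  (∀ i, v i < j i ∧ j i < (S i).card) ∧
  ∀ i, 1 ≤ i → i ≤ (box v j).card →
    ∃ K' ⊆ box v j, K'.card = i ∧ ∀ K ⊆ diamond v j, K.card = i → D S K' ≤ D S K

open Classical in
/-- `(S₁ × ⋯ × S_m) \ (T₁ × ⋯ × T_m)`. -/
noncomputable def removeProduct (S T : Fin m → Finset F) : Finset (Point S) :=
  Finset.univ.filter fun p => ¬ ∀ i, (p i : F) ∈ T i

end MonomialCartesian

/-!
Lower bound on the weights. Multiplying words of `W` by monomials shows that `#Supp(W)` is at least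
the number `D(K)` of monomials of `Δ` that are divisible by a leading monomial of `W`, for a set
`K ⊆ ◇` of `dim W` leading monomials. As the scheme is considerate, `K` may be taken inside `□`.
With `c = s - j - 1` every multiple of a member of `K` by a monomial with exponents at most `c` is
in `Δ`, so `D(K) ≥ #(K + {0, …, c}^m)`.

This sumset is bounded by an isoperimetric inequality. Let `q = z - 1` (`q = 1` if `z = 1`, where
`b = 0`) and choose `κ` and `σ ∈ (0, 1]` with `κ q^σ = c + q` and `κ (q + 1)^σ = c + q + 1`. By
concavity `κ n^σ ≤ c + n` for all natural numbers `n`, which is the case `m = 1` of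
`κ^m (#A)^σ ≤ #(A + {0, …, c}^m)`; induction on `m` over the layers of `A` gives the general case.
For `#A = z^a (z - 1)^b` the left hand side is `(c + z)^a (c + z - 1)^b`.

Upper bound. Let `h_i` be the polynomial with roots `S_i \ T_i`. The multiples of `∏ h_i(X_i)` by
the monomials with exponents less than `#T_i - c` span a space with support `T_1 × ⋯ × T_m`, which
meets `C₂` trivially because the leading monomials lie in `□`.

Reconstruction numbers. Given the shares of `A`, the possible secrets form a coset of the space of
secrets of the words vanishing on `A`. So `A` misses at least `e` of the `ℓ` `q`-bits exactly when
some `W ⊆ C₁` with `W ∩ C₂ = 0` and `dim W = e` vanishes on `A`.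
-/

section Isoperimetry

open scoped Pointwise in
/-- The sumset `A + {0, …, c}^m`. For exponents at most `j` and `c < s - j` it lies in
`Δ` and consists of multiples of the monomials in `A`. -/
def thicken {m : ℕ} (c : ℕ) (A : Finset (Fin m → ℕ)) : Finset (Fin m → ℕ) :=
  A + Finset.Icc 0 fun _ => c

theorem mem_thicken {m c : ℕ} {A : Finset (Fin m → ℕ)} {N : Fin m → ℕ} :
    N ∈ thicken c A ↔ ∃ M ∈ A, ∀ i, M i ≤ N i ∧ N i ≤ M i + c := by
  simp only [thicken, Finset.mem_add, Finset.mem_Icc]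
  constructor
  · rintro ⟨M, hM, w, hw, rfl⟩
    exact ⟨M, hM, fun i => ⟨Nat.le_add_right _ _, Nat.add_le_add_left (hw.2 i) _⟩⟩
  · rintro ⟨M, hM, h⟩
    exact ⟨M, hM, N - M, ⟨zero_le, fun i => Nat.sub_le_iff_le_add'.2 (h i).2⟩,
      add_tsub_cancel_of_le fun i => (h i).1⟩

theorem subset_thicken {m c : ℕ} (A : Finset (Fin m → ℕ)) : A ⊆ thicken c A := fun M hM =>
  mem_thicken.2 ⟨M, hM, fun _ => ⟨le_rfl, Nat.le_add_right _ _⟩⟩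

/-- The section of `A` at height `k` in the first coordinate, for inductions on the dimension. -/
def layer {m : ℕ} (A : Finset (Fin (m + 1) → ℕ)) (k : ℕ) : Finset (Fin m → ℕ) :=
  (A.filter fun x => x 0 = k).image Fin.tail

theorem mem_layer {m : ℕ} {A : Finset (Fin (m + 1) → ℕ)} {k : ℕ} {x : Fin m → ℕ} :
    x ∈ layer A k ↔ Fin.cons k x ∈ A := by
  simp only [layer, Finset.mem_image, Finset.mem_filter]
  constructor
  · rintro ⟨y, ⟨hy, rfl⟩, rfl⟩
    rwa [Fin.cons_self_tail]
  · exact fun h => ⟨_, ⟨h, Fin.cons_zero _ _⟩, Fin.tail_cons _ _⟩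

theorem tail_mem_layer {m : ℕ} {A : Finset (Fin (m + 1) → ℕ)} {x : Fin (m + 1) → ℕ} (hx : x ∈ A) :
    Fin.tail x ∈ layer A (x 0) := by
  rwa [mem_layer, Fin.cons_self_tail]

theorem card_layer {m : ℕ} (A : Finset (Fin (m + 1) → ℕ)) (k : ℕ) :
    (layer A k).card = (A.filter fun x => x 0 = k).card := by
  refine Finset.card_image_of_injOn fun x hx y hy hxy => ?_
  rw [← Fin.cons_self_tail x, ← Fin.cons_self_tail y, hxy, (Finset.mem_filter.1 hx).2,
    (Finset.mem_filter.1 hy).2]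

theorem sum_card_layer_image {m : ℕ} (A : Finset (Fin (m + 1) → ℕ)) :
    ∑ k ∈ A.image (fun x => x 0), (layer A k).card = A.card := by
  simp only [card_layer, ← Finset.card_eq_sum_card_image]

theorem sum_card_layer_le {m : ℕ} (A : Finset (Fin (m + 1) → ℕ)) (J : Finset ℕ) :
    ∑ k ∈ J, (layer A k).card ≤ A.card := by
  simp only [card_layer, Finset.sum_card_fiberwise_eq_card_filter]
  exact Finset.card_filter_le _ _

theorem thicken_layer_subset {m c : ℕ} (A : Finset (Fin (m + 1) → ℕ)) {i k : ℕ} (hik : i ≤ k)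
    (hki : k ≤ i + c) : thicken c (layer A i) ⊆ layer (thicken c A) k := by
  intro x hx
  obtain ⟨M, hM, h⟩ := mem_thicken.1 hx
  exact mem_layer.2 (mem_thicken.2 ⟨_, mem_layer.1 hM, Fin.cases ⟨hik, hki⟩ h⟩)

/-- The heights below `k` are kept and the others are raised by `c`; the `c` heights in the gap all
contain the thickening of the `k`-th layer. -/
theorem mul_card_thicken_layer_add_sum_le {m : ℕ} (c : ℕ) (A : Finset (Fin (m + 1) → ℕ))
    (H : Finset ℕ) (k : ℕ) :
    c * (thicken c (layer A k)).card + ∑ i ∈ H, (thicken c (layer A i)).card ≤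
      (thicken c A).card := by
  set raise : ℕ → ℕ := fun i => if i < k then i else i + c with hraise
  have raise_injective : Function.Injective raise := by
    intro i l h
    simp only [hraise] at h
    split_ifs at h <;> omega
  have hdisjoint : Disjoint (Finset.Ico k (k + c)) (H.image raise) := by
    simp only [Finset.disjoint_left, Finset.mem_Ico, Finset.mem_image, hraise]
    rintro _ hl ⟨i, -, rfl⟩
    split_ifs at hl <;> omega
  have hgap : c * (thicken c (layer A k)).card ≤
      ∑ l ∈ Finset.Ico k (k + c), (layer (thicken c A) l).card := by
    have := Finset.card_nsmul_le_sum (Finset.Ico k (k + c)) (fun l => (layer (thicken c A) l).card)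
      _ fun l hl => Finset.card_le_card <| thicken_layer_subset A (Finset.mem_Ico.1 hl).1
        (Finset.mem_Ico.1 hl).2.le
    simpa using this
  have hraised : ∑ i ∈ H, (thicken c (layer A i)).card ≤
      ∑ i ∈ H, (layer (thicken c A) (raise i)).card := by
    refine Finset.sum_le_sum fun i _ => Finset.card_le_card (thicken_layer_subset A ?_ ?_) <;>
    · simp only [hraise]
      split_ifs <;> omega
  calc _ ≤ _ := add_le_add hgap hraised
    _ = ∑ l ∈ Finset.Ico k (k + c) ∪ H.image raise, (layer (thicken c A) l).card := by
      rw [Finset.sum_union hdisjoint, Finset.sum_image raise_injective.injOn]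
    _ ≤ _ := sum_card_layer_le _ _

theorem add_le_add_of_concaveOn {s : Set ℝ} {f : ℝ → ℝ} (hf : ConcaveOn ℝ s f) {p q u w : ℝ}
    (hp : p ∈ s) (hq : q ∈ s) (hpu : p ≤ u) (huq : u ≤ q) (hsum : u + w = p + q) :
    f p + f q ≤ f u + f w := by
  obtain ⟨α, β, hα, hβ, hαβ, rfl⟩ : u ∈ segment ℝ p q := by
    rw [segment_eq_Icc (hpu.trans huq)]
    exact ⟨hpu, huq⟩
  obtain rfl : w = β • p + α • q := by
    simp only [smul_eq_mul] at hsum ⊢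
    linear_combination hsum - (p + q) * hαβ
  have hu := hf.2 hp hq hα hβ hαβ
  have hw := hf.2 hp hq hβ hα (by rwa [add_comm])
  simp only [smul_eq_mul] at hu hw ⊢
  linear_combination hu + hw - (f p + f q) * hαβ

variable {κ σ : ℝ}

theorem rpow_add_rpow_le {p q u w : ℝ} (hσ0 : 0 ≤ σ) (hσ1 : σ ≤ 1) (hp : 0 ≤ p) (hpu : p ≤ u)
    (huq : u ≤ q) (hsum : u + w = p + q) : p ^ σ + q ^ σ ≤ u ^ σ + w ^ σ :=
  add_le_add_of_concaveOn (Real.concaveOn_rpow hσ0 hσ1) hp (hp.trans (hpu.trans huq)) hpu huq hsum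

theorem add_rpow_le_interpolate {n ρ : ℝ} (hσ0 : 0 ≤ σ) (hσ1 : σ ≤ 1) (hn : 0 ≤ n) (hρ0 : 0 ≤ ρ)
    (hρ1 : ρ ≤ 1) : (n + ρ) ^ σ ≤ (1 - ρ ^ σ) * n ^ σ + ρ ^ σ * (n + 1) ^ σ := by
  have h := rpow_add_rpow_le (p := ρ * n) (q := n + ρ) (u := ρ * (n + 1)) (w := n) hσ0 hσ1
    (by positivity) (by nlinarith) (by nlinarith) (by ring)
  rw [Real.mul_rpow hρ0 hn, Real.mul_rpow hρ0 (by positivity)] at h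
  linarith

/-- Concavity pushes the summands to the ends of the unit interval. -/
theorem exists_natCast_add_rpow_le_sum_rpow {ι : Type*} (hσ0 : 0 < σ) (hσ1 : σ ≤ 1) (x : ι → ℝ)
    (H : Finset ι) (hx : ∀ i ∈ H, 0 ≤ x i ∧ x i ≤ 1) :
    ∃ (n : ℕ) (ρ : ℝ), 0 ≤ ρ ∧ ρ ≤ 1 ∧ ∑ i ∈ H, x i = n + ρ ∧ n + ρ ^ σ ≤ ∑ i ∈ H, x i ^ σ := by
  classical
  induction H using Finset.induction_on with
  | empty => exact ⟨0, 0, le_rfl, zero_le_one, by simp, by simp [Real.zero_rpow hσ0.ne']⟩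
  | insert i H hi ih =>
    obtain ⟨n, ρ, hρ0, hρ1, hsum, hle⟩ := ih fun k hk => hx k (Finset.mem_insert_of_mem hk)
    obtain ⟨hi0, hi1⟩ := hx i (Finset.mem_insert_self i H)
    rw [Finset.sum_insert hi, Finset.sum_insert hi]
    rcases le_total (ρ + x i) 1 with h | h
    · refine ⟨n, ρ + x i, by linarith, h, by linarith, ?_⟩
      have := Real.rpow_add_le_add_rpow hρ0 hi0 hσ0.le hσ1
      linarith
    · refine ⟨n + 1, ρ + x i - 1, by linarith, by linarith, by push_cast; linarith, ?_⟩
      have := rpow_add_rpow_le (p := ρ + x i - 1) (q := 1) (w := x i) hσ0.le hσ1 (by linarith)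
        (by linarith) hρ1 (by ring)
      rw [Real.one_rpow] at this
      push_cast
      linarith

theorem mul_rpow_natCast_add_le {c : ℝ} (hκ0 : 0 ≤ κ) (hσ0 : 0 ≤ σ) (hσ1 : σ ≤ 1)
    (hκ : ∀ n : ℕ, κ * (n : ℝ) ^ σ ≤ c + n) (n : ℕ) {ρ : ℝ} (hρ0 : 0 ≤ ρ)
    (hρ1 : ρ ≤ 1) : κ * (n + ρ) ^ σ ≤ c + (n + ρ ^ σ) := by
  have hsucc := hκ (n + 1)
  push_cast at hsucc
  calc κ * (n + ρ) ^ σ ≤ κ * ((1 - ρ ^ σ) * n ^ σ + ρ ^ σ * (n + 1) ^ σ) := by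
        gcongr
        exact add_rpow_le_interpolate hσ0 hσ1 n.cast_nonneg hρ0 hρ1
    _ = (1 - ρ ^ σ) * (κ * n ^ σ) + ρ ^ σ * (κ * (n + 1) ^ σ) := by ring
    _ ≤ (1 - ρ ^ σ) * (c + n) + ρ ^ σ * (c + (n + 1)) := by
        have := sub_nonneg.2 (Real.rpow_le_one hρ0 hρ1 hσ0)
        gcongr
        exact hκ n
    _ = c + (n + ρ ^ σ) := by ring

theorem mul_sum_rpow_le_of_le_one {ι : Type*} {c : ℝ} (hκ0 : 0 ≤ κ) (hσ0 : 0 < σ) (hσ1 : σ ≤ 1)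
    (hκ : ∀ n : ℕ, κ * (n : ℝ) ^ σ ≤ c + n) (x : ι → ℝ) {H : Finset ι}
    (hx : ∀ i ∈ H, 0 ≤ x i ∧ x i ≤ 1) {k : ι} (hk : k ∈ H) (hxk : x k = 1) :
    κ * (∑ i ∈ H, x i) ^ σ ≤ c + ∑ i ∈ H, x i ^ σ := by
  classical
  obtain ⟨n, ρ, hρ0, hρ1, hsum, hle⟩ := exists_natCast_add_rpow_le_sum_rpow hσ0 hσ1 x (H.erase k)
    fun i hi => hx i (Finset.mem_of_mem_erase hi)
  have h := mul_rpow_natCast_add_le hκ0 hσ0.le hσ1 hκ n.succ hρ0 hρ1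
  rw [← Finset.add_sum_erase H x hk, ← Finset.add_sum_erase H (fun i => x i ^ σ) hk, hsum, hxk,
    Real.one_rpow, show (1 : ℝ) + (n + ρ) = (n.succ : ℕ) + ρ by push_cast; ring]
  push_cast at h ⊢
  linarith

theorem mul_sum_rpow_le {ι : Type*} {c : ℝ} (hκ0 : 0 ≤ κ) (hσ0 : 0 < σ) (hσ1 : σ ≤ 1)
    (hκ : ∀ n : ℕ, κ * (n : ℝ) ^ σ ≤ c + n) (x : ι → ℝ) {H : Finset ι}
    {k : ι} (hk : k ∈ H) (hk0 : 0 < x k) (hx : ∀ i ∈ H, 0 ≤ x i ∧ x i ≤ x k) :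
    κ * (∑ i ∈ H, x i) ^ σ ≤ c * x k ^ σ + ∑ i ∈ H, x i ^ σ := by
  have h := mul_sum_rpow_le_of_le_one hκ0 hσ0 hσ1 hκ (fun i => x i / x k)
    (fun i hi => ⟨div_nonneg (hx i hi).1 hk0.le, (div_le_one hk0).2 (hx i hi).2⟩) hk
    (div_self hk0.ne')
  have hdiv : ∀ i ∈ H, (x i / x k) ^ σ = x i ^ σ / x k ^ σ := fun i hi =>
    Real.div_rpow (hx i hi).1 hk0.le _
  have hkσ : 0 < x k ^ σ := Real.rpow_pos_of_pos hk0 σ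
  rw [← Finset.sum_div, Real.div_rpow (Finset.sum_nonneg fun i hi => (hx i hi).1) hk0.le,
    Finset.sum_congr rfl hdiv, ← Finset.sum_div, ← mul_div_assoc, div_le_iff₀ hkσ, add_mul,
    div_mul_cancel₀ _ hkσ.ne'] at h
  exact h

theorem pow_mul_rpow_card_le_card_thicken {c : ℕ} (hκ0 : 0 ≤ κ) (hσ0 : 0 < σ) (hσ1 : σ ≤ 1)
    (hκ : ∀ n : ℕ, κ * (n : ℝ) ^ σ ≤ c + n) {m : ℕ} {A : Finset (Fin m → ℕ)}
    (hA : A.Nonempty) : κ ^ m * (A.card : ℝ) ^ σ ≤ (thicken c A).card := by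
  induction m with
  | zero =>
    have hcard : A.card = 1 := le_antisymm (Finset.card_le_one_of_subsingleton A) hA.card_pos
    have hle := Finset.card_le_card (subset_thicken (c := c) A)
    rw [hcard] at hle ⊢
    simpa using hle
  | succ m ih =>
    set H := A.image fun x => x 0
    have layer_nonempty : ∀ i ∈ H, (layer A i).Nonempty := by
      intro i hi
      obtain ⟨x, hx, rfl⟩ := Finset.mem_image.1 hi
      exact ⟨_, tail_mem_layer hx⟩
    obtain ⟨k, hk, hmax⟩ := H.exists_max_image (fun i => (layer A i).card) (hA.image _)
    have hsum := mul_sum_rpow_le hκ0 hσ0 hσ1 hκ (fun i => ((layer A i).card : ℝ)) hk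
      (by exact_mod_cast (layer_nonempty k hk).card_pos)
      fun i hi => ⟨Nat.cast_nonneg _, by exact_mod_cast hmax i hi⟩
    calc κ ^ (m + 1) * (A.card : ℝ) ^ σ
        = κ ^ m * (κ * (∑ i ∈ H, ((layer A i).card : ℝ)) ^ σ) := by
          rw [← Nat.cast_sum, sum_card_layer_image, pow_succ, mul_assoc]
      _ ≤ κ ^ m * (c * ((layer A k).card : ℝ) ^ σ + ∑ i ∈ H, ((layer A i).card : ℝ) ^ σ) := by
          gcongr
      _ = c * (κ ^ m * ((layer A k).card : ℝ) ^ σ)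
          + ∑ i ∈ H, κ ^ m * ((layer A i).card : ℝ) ^ σ := by
          rw [mul_add, Finset.mul_sum]
          ring
      _ ≤ c * ((thicken c (layer A k)).card : ℝ) + ∑ i ∈ H, ((thicken c (layer A i)).card : ℝ) := by
          gcongr with i hi
          · exact ih (layer_nonempty k hk)
          · exact ih (layer_nonempty i hi)
      _ ≤ (thicken c A).card := by exact_mod_cast mul_card_thicken_layer_add_sum_le c A H k

theorem exists_mul_rpow_eq_add {c q : ℝ} (hc : 0 ≤ c) (hq : 0 < q) :
    ∃ κ σ : ℝ, 0 ≤ κ ∧ 0 < σ ∧ σ ≤ 1 ∧ κ * q ^ σ = c + q ∧ κ * (q + 1) ^ σ = c + (q + 1) := by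
  have hbase : 1 < (q + 1) / q := (one_lt_div hq).2 (by linarith)
  have hvalue : 1 < (c + (q + 1)) / (c + q) := (one_lt_div (by positivity)).2 (by linarith)
  set σ := Real.logb ((q + 1) / q) ((c + (q + 1)) / (c + q))
  have hpow : (q + 1) ^ σ / q ^ σ = (c + (q + 1)) / (c + q) := by
    rw [← Real.div_rpow (by positivity) hq.le,
      Real.rpow_logb (by positivity) hbase.ne' (by positivity)]
  have hqσ : 0 < q ^ σ := Real.rpow_pos_of_pos hq σ
  refine ⟨(c + q) / q ^ σ, σ, by positivity, Real.logb_pos hbase hvalue, ?_,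
    div_mul_cancel₀ _ hqσ.ne', ?_⟩
  · rw [Real.logb_le_iff_le_rpow hbase (by positivity), Real.rpow_one,
      div_le_div_iff₀ (by positivity) hq]
    nlinarith
  · rw [div_mul_eq_mul_div, mul_div_assoc, hpow, mul_div_cancel₀ _ (by positivity)]

/-- A concave function lies below its chord from `q` to `q + 1` outside the interval between them,
and no natural number is strictly inside. -/
theorem mul_rpow_natCast_le_add {c : ℝ} (hκ0 : 0 ≤ κ) (hσ0 : 0 ≤ σ) (hσ1 : σ ≤ 1) {q : ℕ}
    (hq : κ * (q : ℝ) ^ σ = c + q) (hq' : κ * ((q : ℝ) + 1) ^ σ = c + (q + 1)) (n : ℕ) :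
    κ * (n : ℝ) ^ σ ≤ c + n := by
  have hconcave : ConcaveOn ℝ (Set.Ici 0) fun x : ℝ => κ * x ^ σ :=
    (Real.concaveOn_rpow hσ0 hσ1).smul hκ0
  have hmem : ∀ k : ℕ, (k : ℝ) ∈ Set.Ici (0 : ℝ) := fun k => Set.mem_Ici.2 k.cast_nonneg
  have hmem_succ : (q : ℝ) + 1 ∈ Set.Ici (0 : ℝ) := by exact_mod_cast hmem (q + 1)
  rcases lt_trichotomy n q with h | rfl | h
  · have hnq : (n : ℝ) < q := by exact_mod_cast h
    have := hconcave.slope_anti_adjacent (hmem n) hmem_succ hnq (lt_add_one _)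
    rw [hq, hq', add_sub_add_left_eq_sub, add_sub_cancel_left, div_one,
      le_div_iff₀ (sub_pos.2 hnq)] at this
    linarith
  · exact hq.le
  · rcases (Nat.succ_le_of_lt h).eq_or_lt with rfl | h
    · exact_mod_cast hq'.le
    · have hqn : (q : ℝ) + 1 < n := by exact_mod_cast h
      have := hconcave.slope_anti_adjacent (hmem q) (hmem n) (lt_add_one _) hqn
      rw [hq, hq', add_sub_add_left_eq_sub, add_sub_cancel_left, div_one,
        div_le_iff₀ (sub_pos.2 hqn)] at this
      linarith

theorem prod_add_le_card_thicken {m q : ℕ} (c : ℕ) (hq : 0 < q) {u : Fin m → ℕ}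
    (hu : ∀ i, u i = q ∨ u i = q + 1) {A : Finset (Fin m → ℕ)} (hA : A.card = ∏ i, u i) :
    ∏ i, (c + u i) ≤ (thicken c A).card := by
  obtain ⟨κ, σ, hκ0, hσ0, hσ1, hκq, hκq'⟩ :=
    exists_mul_rpow_eq_add (c := c) (q := q) c.cast_nonneg (by exact_mod_cast hq)
  have hA0 : A.Nonempty := by
    rw [← Finset.card_pos, hA]
    exact Finset.prod_pos fun i _ => by rcases hu i with h | h <;> omega
  have hfactor : ∀ i, κ * (u i : ℝ) ^ σ = c + u i := fun i => by
    rcases hu i with h | h <;> rw [h]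
    · exact hκq
    · exact_mod_cast hκq'
  have h := pow_mul_rpow_card_le_card_thicken (c := c) hκ0 hσ0 hσ1
    (mul_rpow_natCast_le_add hκ0 hσ0.le hσ1 hκq hκq') hA0
  have hprod : κ ^ m * (A.card : ℝ) ^ σ = ∏ i, ((c : ℝ) + u i) := by
    rw [hA, Nat.cast_prod, ← Real.finsetProd_rpow _ _ fun i _ => (u i).cast_nonneg,
      ← Finset.prod_congr rfl fun i _ => hfactor i, Finset.prod_mul_distrib, Fin.prod_const]
  rw [hprod] at h
  exact_mod_cast h

end Isoperimetry

theorem card_le_ncard_of_linearIndependent_of_forall_notMem {F ι κ : Type*} [Field F] [Fintype ι]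
    [Finite κ] {g : ι → κ → F} (hg : LinearIndependent F g) {T : Set κ}
    (hT : ∀ i, ∀ p ∉ T, g i p = 0) : Fintype.card ι ≤ T.ncard := by
  have := Fintype.ofFinite T
  have hrestrict : LinearIndependent F fun i => fun p : T => g i p := by
    rw [Fintype.linearIndependent_iff] at hg ⊢
    refine fun a ha => hg a (funext fun p => ?_)
    by_cases hp : p ∈ T
    · simpa using congrFun ha ⟨p, hp⟩
    · simp [hT _ p hp]
  have hcard := hrestrict.fintype_card_le_finrank
  rwa [Module.finrank_fintype_fun_eq_card, Fintype.card_eq_nat_card (α := T),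
    Nat.card_coe_set_eq] at hcard

namespace MonomialCartesian

variable {m : ℕ} {F : Type*}

theorem mem_delta {S : Fin m → Finset F} {M : Fin m → ℕ} :
    M ∈ delta S ↔ ∀ i, M i < (S i).card := by
  simp [delta]

theorem L₁_subset_delta {S : Fin m → Finset F} {j : Fin m → ℕ} (hj : ∀ i, j i < (S i).card) :
    L₁ j ⊆ delta S := fun _ hM =>
  mem_delta.2 fun i => ((Finset.mem_Icc.1 hM).2 i).trans_lt (hj i)

theorem box_subset_L₁ (v j : Fin m → ℕ) : box v j ⊆ L₁ j :=
  Finset.Icc_subset_Icc_left zero_le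

theorem card_thicken_le_D (S : Fin m → Finset F) {j : Fin m → ℕ} {c : ℕ}
    (hc : ∀ i, j i + c < (S i).card) {K : Finset (Fin m → ℕ)} (hK : K ⊆ L₁ j) :
    (thicken c K).card ≤ D S K := by
  classical
  refine Finset.card_le_card fun N hN => ?_
  obtain ⟨M, hM, hMN⟩ := mem_thicken.1 hN
  refine Finset.mem_filter.2 ⟨mem_delta.2 fun i => ?_, M, hM, fun i => (hMN i).1⟩
  exact ((hMN i).2.trans (Nat.add_le_add_right ((Finset.mem_Icc.1 (hK hM)).2 i) c)).trans_lt (hc i)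

theorem ncard_setOf_forall_mem {S T : Fin m → Finset F} (hT : ∀ i, T i ⊆ S i) :
    {p : Point S | ∀ i, (p i : F) ∈ T i}.ncard = ∏ i, (T i).card := by
  classical
  have hpi : {p : Point S | ∀ i, (p i : F) ∈ T i} =
      (Fintype.piFinset fun i => (T i).subtype (· ∈ S i) : Finset (Point S)) := by
    ext p
    simp
  rw [hpi, Set.ncard_coe_finset, Fintype.card_piFinset]
  refine Finset.prod_congr rfl fun i _ => ?_
  rw [Finset.card_subtype, Finset.filter_true_of_mem (hT i)]

theorem card_removeProduct_add {S T : Fin m → Finset F} (hT : ∀ i, T i ⊆ S i) :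
    (removeProduct S T).card + ∏ i, (T i).card = Fintype.card (Point S) := by
  classical
  have hcard : (Finset.univ.filter fun p : Point S => ∀ i, (p i : F) ∈ T i).card =
      ∏ i, (T i).card := by
    rw [← ncard_setOf_forall_mem hT, ← Set.ncard_coe_finset]
    simp
  rw [removeProduct, ← hcard, add_comm, Finset.card_filter_add_card_filter_not, Finset.card_univ]

variable [Field F]

theorem ev_mono_apply (S : Fin m → Finset F) (M : Fin m → ℕ) (p : Point S) :
    ev S (mono F M) p = ∏ i, (p i : F) ^ M i := by
  simp [ev, mono, map_prod]

theorem ev_mono_add (S : Fin m → Finset F) (M N : Fin m → ℕ) :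
    ev S (mono F (M + N)) = ev S (mono F M) * ev S (mono F N) := by
  ext p
  simp [ev_mono_apply, pow_add, Finset.prod_mul_distrib]

theorem mono_eq_monomial (M : Fin m → ℕ) :
    mono F M = MvPolynomial.monomial (Finsupp.equivFunOnFinite.symm M) 1 := by
  rw [MvPolynomial.monomial_eq, Finsupp.prod_fintype _ _ (by simp)]
  simp [mono]

theorem linearIndepOn_ev_mono (S : Fin m → Finset F) :
    LinearIndepOn F (fun M => ev S (mono F M)) (delta S : Set (Fin m → ℕ)) := by
  classical
  rw [linearIndepOn_finset_iff]
  intro a ha M hM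
  set Q : MvPolynomial (Fin m) F := ∑ N ∈ delta S, a N • mono F N
  have hcoeff : ∀ k, Q.coeff k = if Finsupp.equivFunOnFinite k ∈ delta S
      then a (Finsupp.equivFunOnFinite k) else 0 := by
    intro k
    simp only [Q, MvPolynomial.coeff_sum, MvPolynomial.coeff_smul, mono_eq_monomial,
      MvPolynomial.coeff_monomial, Equiv.symm_apply_eq, smul_eq_mul, mul_ite, mul_one, mul_zero,
      Finset.sum_ite_eq']
  have hQ : Q = 0 := by
    refine MvPolynomial.eq_zero_of_eval_zero_at_prod_finset Q S (fun i => ?_) fun x hx => ?_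
    · rw [MvPolynomial.degreeOf_lt_iff ((Nat.zero_le _).trans_lt (mem_delta.1 hM i))]
      intro k hk
      rw [MvPolynomial.mem_support_iff, hcoeff] at hk
      exact mem_delta.1 (ite_ne_right_iff.1 hk).1 i
    · have hev : ev S Q = 0 := by simpa [Q] using ha
      exact congrFun hev fun i => ⟨x i, hx i⟩
  simpa [hQ, hM] using (hcoeff (Finsupp.equivFunOnFinite.symm M)).symm

theorem code_eq_span (S : Fin m → Finset F) (L : Finset (Fin m → ℕ)) :
    code S L = Submodule.span F ((fun M => ev S (mono F M)) '' (L : Set (Fin m → ℕ))) := by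
  rw [code, Submodule.map_span, Set.image_image]

theorem ev_mono_mem_code (S : Fin m → Finset F) {L : Finset (Fin m → ℕ)} {M : Fin m → ℕ}
    (hM : M ∈ L) : ev S (mono F M) ∈ code S L := by
  rw [code_eq_span]
  exact Submodule.subset_span ⟨M, hM, rfl⟩

theorem code_mono (S : Fin m → Finset F) {L L' : Finset (Fin m → ℕ)} (h : L ⊆ L') :
    code S L ≤ code S L' :=
  Submodule.map_mono (Submodule.span_mono (Set.image_mono h))

theorem mem_code {S : Fin m → Finset F} {L : Finset (Fin m → ℕ)} {w : Point S → F} :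
    w ∈ code S L ↔ ∃ C : (Fin m → ℕ) → F, ∑ M ∈ L, C M • ev S (mono F M) = w := by
  refine ⟨fun hw => ?_, ?_⟩
  · rw [code_eq_span, Submodule.mem_span_image_finset_iff_exists_fun] at hw
    obtain ⟨C, rfl⟩ := hw
    refine ⟨Function.extend (fun M : L => (M : Fin m → ℕ)) C 0, ?_⟩
    rw [← Finset.sum_coe_sort]
    exact Finset.sum_congr rfl fun M _ => by rw [Subtype.val_injective.extend_apply]
  · rintro ⟨C, rfl⟩
    exact Submodule.sum_mem _ fun M hM => Submodule.smul_mem _ _ (ev_mono_mem_code S hM)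

theorem finrank_code {S : Fin m → Finset F} {L : Finset (Fin m → ℕ)} (hL : L ⊆ delta S) :
    Module.finrank F (code S L) = L.card := by
  have h : LinearIndepOn F (fun M => ev S (mono F M)) (L : Set (Fin m → ℕ)) :=
    (linearIndepOn_ev_mono S).mono hL
  rw [code_eq_span, Set.image_eq_range, finrank_span_eq_card h]
  exact Fintype.card_coe L

theorem mul_mem_code {S : Fin m → Finset F} {E L L' : Finset (Fin m → ℕ)}
    (h : ∀ k ∈ E, ∀ M ∈ L, k + M ∈ L') {w w' : Point S → F} (hw : w ∈ code S E)
    (hw' : w' ∈ code S L) : w * w' ∈ code S L' := by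
  obtain ⟨C, rfl⟩ := mem_code.1 hw
  obtain ⟨C', rfl⟩ := mem_code.1 hw'
  rw [Finset.sum_mul_sum]
  refine Submodule.sum_mem _ fun k hk => Submodule.sum_mem _ fun M hM => ?_
  rw [smul_mul_smul_comm, ← ev_mono_add]
  exact Submodule.smul_mem _ _ (ev_mono_mem_code S (h k hk M hM))

/-- The word of values of the product `h₁(X₁) ⋯ h_m(X_m)` of univariate polynomials. -/
noncomputable def prodEval (S : Fin m → Finset F) (h : Fin m → Polynomial F) : Point S → F :=
  fun p => ∏ i, (h i).eval (p i : F)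

theorem prodEval_eq_sum (S : Fin m → Finset F) (h : Fin m → Polynomial F) :
    prodEval S h = ∑ M ∈ Fintype.piFinset fun i => (h i).support,
      (∏ i, (h i).coeff (M i)) • ev S (mono F M) := by
  ext p
  simp only [prodEval, Polynomial.eval_eq_sum, Polynomial.sum_def, Finset.prod_univ_sum,
    Finset.prod_mul_distrib, Finset.sum_apply, Pi.smul_apply, ev_mono_apply, smul_eq_mul]

theorem prodEval_mem_code (S : Fin m → Finset F) {h : Fin m → Polynomial F}
    {L : Finset (Fin m → ℕ)} (hL : ∀ M : Fin m → ℕ, (∀ i, M i ∈ (h i).support) → M ∈ L) :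
    prodEval S h ∈ code S L := by
  rw [prodEval_eq_sum]
  exact Submodule.sum_mem _ fun M hM =>
    Submodule.smul_mem _ _ (ev_mono_mem_code S (hL M (Fintype.mem_piFinset.1 hM)))

theorem exists_polynomial_eval_eq_pow (T : Finset F) (k : ℕ) : ∃ r : Polynomial F,
    r.degree < T.card ∧ r.natDegree ≤ k ∧ ∀ x ∈ T, r.eval x = x ^ k := by
  have hmonic : (Lagrange.nodal T id : Polynomial F).Monic := Lagrange.nodal_monic
  refine ⟨(Polynomial.X ^ k) %ₘ Lagrange.nodal T id, ?_, ?_, fun x hx => ?_⟩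
  · simpa only [Lagrange.degree_nodal] using
      Polynomial.degree_modByMonic_lt (Polynomial.X ^ k) hmonic
  · exact (Polynomial.natDegree_modByMonic_le_left).trans (Polynomial.natDegree_X_pow_le k)
  · have hroot : Polynomial.aeval x (Lagrange.nodal T id) = 0 := by
      rw [Polynomial.coe_aeval_eq_eval]
      exact Lagrange.eval_nodal_at_node (v := id) hx
    simpa using Polynomial.aeval_modByMonic_eq_self_of_root (p := Polynomial.X ^ k) hroot

/-- Reduction modulo the vanishing ideal of the point set only lowers exponents. -/
theorem ev_mono_mem_code_delta_inter (S : Fin m → Finset F) (N : Fin m → ℕ) :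
    ev S (mono F N) ∈ code S (delta S ∩ L₁ N) := by
  choose r hcard hle heval using fun i => exists_polynomial_eval_eq_pow (S i) (N i)
  have hr : ev S (mono F N) = prodEval S r := by
    ext p
    rw [ev_mono_apply]
    exact Finset.prod_congr rfl fun i _ => (heval i _ (p i).2).symm
  rw [hr]
  refine prodEval_mem_code S fun M hM => Finset.mem_inter.2 ⟨mem_delta.2 fun i => ?_,
    Finset.mem_Icc.2 ⟨zero_le, fun i => ?_⟩⟩
  · exact_mod_cast (Polynomial.le_degree_of_mem_supp _ (hM i)).trans_lt (hcard i)
  · exact (Polynomial.le_natDegree_of_mem_supp _ (hM i)).trans (hle i)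

/-- The span of the evaluations of the monomials that are lexicographically below `N`. -/
noncomputable def lowerSpan (S : Fin m → Finset F) (N : Fin m → ℕ) : Submodule F (Point S → F) :=
  Submodule.span F ((fun M => ev S (mono F M)) '' {M | toLex M < toLex N})

theorem ev_mono_mem_lowerSpan (S : Fin m → Finset F) {M N : Fin m → ℕ} (h : toLex M < toLex N) :
    ev S (mono F M) ∈ lowerSpan S N :=
  Submodule.subset_span ⟨M, h, rfl⟩

theorem lowerSpan_mono (S : Fin m → Finset F) {M N : Fin m → ℕ} (h : toLex M ≤ toLex N) :
    lowerSpan S M ≤ lowerSpan S N :=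
  Submodule.span_mono (Set.image_mono fun _ hK => lt_of_lt_of_le hK h)

theorem ev_mono_notMem_lowerSpan {S : Fin m → Finset F} {N : Fin m → ℕ} (hN : N ∈ delta S) :
    ev S (mono F N) ∉ lowerSpan S N := by
  have hle : lowerSpan S N ≤
      Submodule.span F ((fun M => ev S (mono F M)) '' (delta S \ {N} : Set (Fin m → ℕ))) := by
    refine Submodule.span_le.2 ?_
    rintro _ ⟨M, hM, rfl⟩
    have hmem := ev_mono_mem_code_delta_inter S M
    rw [code_eq_span] at hmem
    refine Submodule.span_mono (Set.image_mono fun K hK => ?_) hmem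
    obtain ⟨hKdelta, hKM⟩ := Finset.mem_inter.1 hK
    refine ⟨hKdelta, ?_⟩
    rintro rfl
    exact (Pi.toLex_monotone (Finset.mem_Icc.1 hKM).2).not_gt hM
  exact fun h => (linearIndepOn_ev_mono S).notMem_span hN (hle h)

theorem mul_ev_mono_mem_lowerSpan {S : Fin m → Finset F} {M N : Fin m → ℕ} {w : Point S → F}
    (hw : w ∈ lowerSpan S M) : w * ev S (mono F N) ∈ lowerSpan S (M + N) := by
  induction hw using Submodule.span_induction with
  | mem w hw =>
    obtain ⟨K, hK, rfl⟩ := hw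
    simp only [← ev_mono_add]
    exact ev_mono_mem_lowerSpan S (by simpa using hK)
  | zero => rw [zero_mul]; exact Submodule.zero_mem _
  | add w w' _ _ ih ih' => rw [add_mul]; exact Submodule.add_mem _ ih ih'
  | smul a w _ ih => rw [smul_mul_assoc]; exact Submodule.smul_mem _ a ih

theorem mul_mem_lowerSpan {S : Fin m → Finset F} {M N : Fin m → ℕ} {w w' : Point S → F}
    (hw : w ∈ lowerSpan S M) (hw' : w' ∈ lowerSpan S N) : w * w' ∈ lowerSpan S (M + N) := by
  induction hw' using Submodule.span_induction with
  | mem w' hw' =>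
    obtain ⟨K, hK, rfl⟩ := hw'
    have hlt : toLex (M + K) < toLex (M + N) := by simpa using hK
    exact lowerSpan_mono S hlt.le (mul_ev_mono_mem_lowerSpan hw)
  | zero => rw [mul_zero]; exact Submodule.zero_mem _
  | add w' w'' _ _ ih ih' => rw [mul_add]; exact Submodule.add_mem _ ih ih'
  | smul a w' _ ih => rw [mul_smul_comm]; exact Submodule.smul_mem _ a ih

/-- `N` is a leading monomial of the word `w` for the lexicographic ordering. A word can have
several leading monomials, because the evaluations of the monomials are linearly dependent, but at
most one of them lies in `delta S`. -/
def HasLeading (S : Fin m → Finset F) (w : Point S → F) (N : Fin m → ℕ) : Prop :=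
  ∃ a : F, a ≠ 0 ∧ w - a • ev S (mono F N) ∈ lowerSpan S N

theorem hasLeading_ev_mono (S : Fin m → Finset F) (N : Fin m → ℕ) :
    HasLeading S (ev S (mono F N)) N :=
  ⟨1, one_ne_zero, by simp⟩

namespace HasLeading

variable {S : Fin m → Finset F} {w w' : Point S → F} {M N : Fin m → ℕ}

theorem mem_lowerSpan (h : HasLeading S w M) (hMN : toLex M < toLex N) : w ∈ lowerSpan S N := by
  obtain ⟨a, -, hw⟩ := h
  rw [← sub_add_cancel w (a • ev S (mono F M))]
  exact Submodule.add_mem _ (lowerSpan_mono S hMN.le hw)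
    (Submodule.smul_mem _ a (ev_mono_mem_lowerSpan S hMN))

theorem notMem_lowerSpan (h : HasLeading S w N) (hN : N ∈ delta S) : w ∉ lowerSpan S N := by
  obtain ⟨a, ha, hw⟩ := h
  intro hmem
  have hsmul := Submodule.sub_mem _ hmem hw
  rw [sub_sub_cancel] at hsmul
  exact ev_mono_notMem_lowerSpan hN ((Submodule.smul_mem_iff _ ha).1 hsmul)

theorem ne_zero (h : HasLeading S w N) (hN : N ∈ delta S) : w ≠ 0 := by
  rintro rfl
  exact h.notMem_lowerSpan hN (Submodule.zero_mem _)

theorem unique (hM : HasLeading S w M) (hN : HasLeading S w N) (hMΔ : M ∈ delta S)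
    (hNΔ : N ∈ delta S) : M = N := by
  rcases lt_trichotomy (toLex M) (toLex N) with h | h | h
  · exact absurd (hM.mem_lowerSpan h) (hN.notMem_lowerSpan hNΔ)
  · exact toLex.injective h
  · exact absurd (hN.mem_lowerSpan h) (hM.notMem_lowerSpan hMΔ)

theorem smul (h : HasLeading S w N) {b : F} (hb : b ≠ 0) : HasLeading S (b • w) N := by
  obtain ⟨a, ha, hw⟩ := h
  refine ⟨b * a, mul_ne_zero hb ha, ?_⟩
  rw [mul_smul, ← smul_sub]
  exact Submodule.smul_mem _ b hw

theorem add_of_mem_lowerSpan (h : HasLeading S w N) (hw' : w' ∈ lowerSpan S N) :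
    HasLeading S (w + w') N := by
  obtain ⟨a, ha, hw⟩ := h
  refine ⟨a, ha, ?_⟩
  rw [add_sub_right_comm]
  exact Submodule.add_mem _ hw hw'

theorem mul (hM : HasLeading S w M) (hN : HasLeading S w' N) : HasLeading S (w * w') (M + N) := by
  obtain ⟨a, ha, hw⟩ := hM
  obtain ⟨b, hb, hw'⟩ := hN
  refine ⟨a * b, mul_ne_zero ha hb, ?_⟩
  set x := ev S (mono F M) with hx
  set y := ev S (mono F N) with hy
  have hsplit : w * w' - (a * b) • ev S (mono F (M + N)) =
      (w - a • x) * (w' - b • y) + b • ((w - a • x) * y) + a • ((w' - b • y) * x) := by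
    rw [ev_mono_add]
    simp only [← hx, ← hy, Algebra.smul_def, map_mul]
    ring
  rw [hsplit]
  exact Submodule.add_mem _ (Submodule.add_mem _ (mul_mem_lowerSpan hw hw')
    (Submodule.smul_mem _ b (mul_ev_mono_mem_lowerSpan hw)))
    (Submodule.smul_mem _ a (add_comm N M ▸ mul_ev_mono_mem_lowerSpan hw'))

end HasLeading

theorem exists_hasLeading_sum {S : Fin m → Finset F} {E : Finset (Fin m → ℕ)}
    {g : (Fin m → ℕ) → Point S → F} (hg : ∀ M ∈ E, HasLeading S (g M) M) {b : (Fin m → ℕ) → F}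
    (hb : ∃ M ∈ E, b M ≠ 0) :
    ∃ N ∈ E, HasLeading S (∑ M ∈ E, b M • g M) N ∧
      ∀ M ∈ E, b M ≠ 0 → toLex M ≤ toLex N := by
  classical
  obtain ⟨N, hN, hmax⟩ := (E.filter fun M => b M ≠ 0).exists_max_image toLex
    (Finset.filter_nonempty_iff.2 hb)
  obtain ⟨hNE, hbN⟩ := Finset.mem_filter.1 hN
  have hmax : ∀ M ∈ E, b M ≠ 0 → toLex M ≤ toLex N := fun M hM hbM =>
    hmax M (Finset.mem_filter.2 ⟨hM, hbM⟩)
  refine ⟨N, hNE, ?_, hmax⟩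
  rw [← Finset.add_sum_erase _ _ hNE]
  refine ((hg N hNE).smul hbN).add_of_mem_lowerSpan (Submodule.sum_mem _ fun M hM => ?_)
  obtain ⟨hMN, hME⟩ := Finset.mem_erase.1 hM
  by_cases hbM : b M = 0
  · rw [hbM, zero_smul]
    exact Submodule.zero_mem _
  · exact Submodule.smul_mem _ _ ((hg M hME).mem_lowerSpan
      (lt_of_le_of_ne (hmax M hME hbM) fun h => hMN (toLex.injective h)))

theorem linearIndepOn_of_hasLeading {S : Fin m → Finset F} {E : Finset (Fin m → ℕ)}
    (hE : E ⊆ delta S) {g : (Fin m → ℕ) → Point S → F} (hg : ∀ M ∈ E, HasLeading S (g M) M) :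
    LinearIndepOn F g (E : Set (Fin m → ℕ)) := by
  rw [linearIndepOn_finset_iff]
  intro b hb
  by_contra! hne
  obtain ⟨N, hN, hlead, -⟩ := exists_hasLeading_sum hg hne
  exact hlead.ne_zero (hE hN) hb

open Classical in
theorem exists_hasLeading_of_mem_code {S : Fin m → Finset F} {L : Finset (Fin m → ℕ)}
    {w : Point S → F} (hw : w ∈ code S L) (hw0 : w ≠ 0) :
    ∃ N ∈ L, HasLeading S w N ∧ w ∈ code S (L.filter fun M => toLex M ≤ toLex N) := by
  obtain ⟨C, rfl⟩ := mem_code.1 hw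
  have hC : ∃ M ∈ L, C M ≠ 0 := by
    by_contra! hC
    exact hw0 (Finset.sum_eq_zero fun M hM => by rw [hC M hM, zero_smul])
  obtain ⟨N, hN, hlead, hmax⟩ := exists_hasLeading_sum (fun M _ => hasLeading_ev_mono S M) hC
  refine ⟨N, hN, hlead, Submodule.sum_mem _ fun M hM => ?_⟩
  by_cases hCM : C M = 0
  · rw [hCM, zero_smul]
    exact Submodule.zero_mem _
  · exact Submodule.smul_mem _ _ (ev_mono_mem_code S (Finset.mem_filter.2 ⟨hM, hmax M hM hCM⟩))

theorem hasLeading_prodEval (S : Fin m → Finset F) {h : Fin m → Polynomial F}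
    (hh : ∀ i, h i ≠ 0) : HasLeading S (prodEval S h) fun i => (h i).natDegree := by
  have hdegree : (fun i => (h i).natDegree) ∈ Fintype.piFinset fun i => (h i).support :=
    Fintype.mem_piFinset.2 fun i => Polynomial.natDegree_mem_support_of_nonzero (hh i)
  have hcoeff : ∏ i, (h i).coeff (h i).natDegree ≠ 0 :=
    Finset.prod_ne_zero_iff.2 fun i _ => Polynomial.leadingCoeff_ne_zero.2 (hh i)
  obtain ⟨N, hN, hlead, hmax⟩ := exists_hasLeading_sum (fun M _ => hasLeading_ev_mono S M)
    (b := fun M => ∏ i, (h i).coeff (M i)) ⟨_, hdegree, hcoeff⟩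
  have hle : N ≤ fun i => (h i).natDegree := fun i =>
    Polynomial.le_natDegree_of_mem_supp _ (Fintype.mem_piFinset.1 hN i)
  rw [prodEval_eq_sum, ← toLex.injective ((Pi.toLex_monotone hle).antisymm (hmax _ hdegree hcoeff))]
  exact hlead

theorem D_le_ncard_codeSupport {S : Fin m → Finset F} {W : Submodule F (Point S → F)}
    {K : Finset (Fin m → ℕ)} (hK : ∀ M ∈ K, ∃ w ∈ W, HasLeading S w M) :
    D S K ≤ (codeSupport W).ncard := by
  classical
  have hmultiple : ∀ N ∈ (delta S).filter fun N => ∃ M ∈ K, M ≤ N,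
      ∃ g : Point S → F, HasLeading S g N ∧ ∀ p ∉ codeSupport W, g p = 0 := by
    intro N hN
    obtain ⟨-, M, hM, hMN⟩ := Finset.mem_filter.1 hN
    obtain ⟨w, hw, hlead⟩ := hK M hM
    refine ⟨ev S (mono F (N - M)) * w, ?_, fun p hp => ?_⟩
    · simpa only [tsub_add_cancel_of_le hMN] using (hasLeading_ev_mono S (N - M)).mul hlead
    · have hwp : w p = 0 := by_contra fun hwp => hp ⟨w, hw, hwp⟩
      rw [Pi.mul_apply, hwp, mul_zero]
  choose! g hlead hsupport using hmultiple
  have hindep := linearIndepOn_of_hasLeading (Finset.filter_subset _ _) hlead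
  simpa [D] using card_le_ncard_of_linearIndependent_of_forall_notMem
    (T := codeSupport W) hindep fun N => hsupport N N.2

theorem finrank_le_card_of_inf_code_sdiff_eq_bot {S : Fin m → Finset F}
    {L K : Finset (Fin m → ℕ)} (hL : L ⊆ delta S) (hK : K ⊆ L) {W : Submodule F (Point S → F)}
    (hW : W ≤ code S L) (hWK : W ⊓ code S (L \ K) = ⊥) : Module.finrank F W ≤ K.card := by
  have hsup := Submodule.finrank_sup_add_finrank_inf_eq W (code S (L \ K))
  have hle := Submodule.finrank_mono (sup_le hW (code_mono S Finset.sdiff_subset :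
    code S (L \ K) ≤ code S L))
  rw [hWK, finrank_bot, finrank_code (Finset.sdiff_subset.trans hL)] at hsup
  rw [finrank_code hL] at hle
  have := Finset.card_sdiff_add_card_eq_card hK
  omega

theorem exists_subset_diamond_D_le {S : Fin m → Finset F} {v j : Fin m → ℕ}
    (hj : ∀ i, j i < (S i).card) {W : Submodule F (Point S → F)} (hW₁ : W ≤ code S (L₁ j))
    (hW₂ : W ⊓ code S (L₂ v j) = ⊥) :
    ∃ K ⊆ diamond v j, K.card = Module.finrank F W ∧ D S K ≤ (codeSupport W).ncard := by
  classical
  set K := (diamond v j).filter fun N => ∃ w ∈ W, HasLeading S w N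
  have hKdiamond : K ⊆ diamond v j := Finset.filter_subset _ _
  have hinf : W ⊓ code S (L₁ j \ K) = ⊥ := by
    refine (Submodule.eq_bot_iff _).2 fun w ⟨hwW, hw⟩ => by_contra fun hw0 => ?_
    obtain ⟨N, hN, hlead, hle⟩ := exists_hasLeading_of_mem_code hw hw0
    obtain ⟨hNL, hNK⟩ := Finset.mem_sdiff.1 hN
    have hNv : ¬ toLex v ≤ toLex N := fun h =>
      hNK (Finset.mem_filter.2 ⟨Finset.mem_filter.2 ⟨hNL, h⟩, w, hwW, hlead⟩)
    have hbelow : ((L₁ j \ K).filter fun M => toLex M ≤ toLex N) ⊆ L₂ v j := by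
      intro M hM
      obtain ⟨hM, hMN⟩ := Finset.mem_filter.1 hM
      exact Finset.mem_sdiff.2 ⟨(Finset.mem_sdiff.1 hM).1, fun hbox =>
        hNv ((Pi.toLex_monotone (Finset.mem_Icc.1 hbox).1).trans hMN)⟩
    exact hw0 ((Submodule.eq_bot_iff _).1 hW₂ w ⟨hwW, code_mono S hbelow hle⟩)
  obtain ⟨K', hK', hcard⟩ := Finset.exists_subset_card_eq <|
    finrank_le_card_of_inf_code_sdiff_eq_bot (L₁_subset_delta hj)
      (hKdiamond.trans (Finset.filter_subset _ _)) hW₁ hinf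
  exact ⟨K', hK'.trans hKdiamond, hcard,
    D_le_ncard_codeSupport fun M hM => (Finset.mem_filter.1 (hK' hM)).2⟩

/-- The multiples of `h₁(X₁) ⋯ h_m(X_m)` by the words of `C(E)`. When each `h_i` vanishes
exactly on `S_i \ T_i`, they form a space of words with support in `T₁ × ⋯ × T_m`. -/
noncomputable def multiples (S : Fin m → Finset F) (E : Finset (Fin m → ℕ))
    (h : Fin m → Polynomial F) : Submodule F (Point S → F) :=
  (code S E).map (LinearMap.mulRight F (prodEval S h))

section Multiples

variable {S : Fin m → Finset F} {E L : Finset (Fin m → ℕ)} {h : Fin m → Polynomial F}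

theorem mem_multiples {w : Point S → F} :
    w ∈ multiples S E h ↔ ∃ c ∈ code S E, c * prodEval S h = w := by
  simp [multiples]

theorem multiples_le_code
    (hL : ∀ k ∈ E, ∀ M : Fin m → ℕ, (∀ i, M i ≤ (h i).natDegree) → k + M ∈ L) :
    multiples S E h ≤ code S L := by
  classical
  intro w hw
  obtain ⟨c, hc, rfl⟩ := mem_multiples.1 hw
  refine mul_mem_code (L := Finset.Iic fun i => (h i).natDegree)
    (fun k hk M hM => hL k hk M (Finset.mem_Iic.1 hM)) hc (prodEval_mem_code S fun M hM => ?_)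
  exact Finset.mem_Iic.2 fun i => Polynomial.le_natDegree_of_mem_supp _ (hM i)

theorem exists_hasLeading_mul_prodEval (hh : ∀ i, h i ≠ 0) {c : Point S → F} (hc : c ∈ code S E)
    (hc0 : c ≠ 0) : ∃ k ∈ E, HasLeading S (c * prodEval S h) (k + fun i => (h i).natDegree) := by
  obtain ⟨k, hk, hlead, -⟩ := exists_hasLeading_of_mem_code hc hc0
  exact ⟨k, hk, hlead.mul (hasLeading_prodEval S hh)⟩

theorem finrank_multiples (hh : ∀ i, h i ≠ 0)
    (hE : ∀ k ∈ E, (k + fun i => (h i).natDegree) ∈ delta S) :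
    Module.finrank F (multiples S E h) = E.card := by
  have hEΔ : E ⊆ delta S := fun k hk => mem_delta.2 fun i =>
    (Nat.le_add_right _ _).trans_lt (mem_delta.1 (hE k hk) i)
  have hker : LinearMap.ker ((LinearMap.mulRight F (prodEval S h)).domRestrict (code S E)) = ⊥ := by
    refine LinearMap.ker_eq_bot'.2 fun c hc => by_contra fun hc0 => ?_
    obtain ⟨k, hk, hlead⟩ := exists_hasLeading_mul_prodEval hh c.2 (Subtype.coe_ne_coe.2 hc0)
    exact hlead.ne_zero (hE k hk) hc
  rw [multiples, ← LinearMap.range_domRestrict,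
    LinearMap.finrank_range_of_inj (LinearMap.ker_eq_bot.1 hker), finrank_code hEΔ]

theorem multiples_inf_code_eq_bot (hh : ∀ i, h i ≠ 0)
    (hE : ∀ k ∈ E, (k + fun i => (h i).natDegree) ∈ delta S \ L) (hL : L ⊆ delta S) :
    multiples S E h ⊓ code S L = ⊥ := by
  refine (Submodule.eq_bot_iff _).2 fun w ⟨hw, hwL⟩ => by_contra fun hw0 => ?_
  obtain ⟨c, hc, rfl⟩ := mem_multiples.1 hw
  obtain ⟨k, hk, hlead⟩ := exists_hasLeading_mul_prodEval hh hc (left_ne_zero_of_mul hw0)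
  obtain ⟨N, hN, hleadN, -⟩ := exists_hasLeading_of_mem_code hwL hw0
  obtain ⟨hkΔ, hkL⟩ := Finset.mem_sdiff.1 (hE k hk)
  exact hkL (hlead.unique hleadN hkΔ (hL hN) ▸ hN)

theorem codeSupport_multiples (hE : 0 ∈ E) :
    codeSupport (multiples S E h) = {p | ∀ i, (h i).eval (p i : F) ≠ 0} := by
  ext p
  have hprod : prodEval S h p ≠ 0 ↔ ∀ i, (h i).eval (p i : F) ≠ 0 := by
    simp [prodEval, Finset.prod_ne_zero_iff]
  rw [Set.mem_ofPred_eq, ← hprod]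
  constructor
  · rintro ⟨w, hw, hwp⟩
    obtain ⟨c, -, rfl⟩ := mem_multiples.1 hw
    exact right_ne_zero_of_mul hwp
  · exact fun hp => ⟨_, mem_multiples.2 ⟨_, ev_mono_mem_code S hE, rfl⟩, by
      simpa [ev_mono_apply] using hp⟩

end Multiples

open Classical in
theorem eval_nodal_sdiff_ne_zero_iff {A B : Finset F} {x : F} (hx : x ∈ A) :
    (Lagrange.nodal (A \ B) id).eval x ≠ 0 ↔ x ∈ B := by
  rw [Lagrange.eval_nodal, Finset.prod_ne_zero_iff]
  constructor
  · exact fun h => by_contra fun hxB => h x (Finset.mem_sdiff.2 ⟨hx, hxB⟩) (sub_self x)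
  · intro hxB y hy hxy
    obtain rfl : x = y := sub_eq_zero.1 hxy
    exact (Finset.mem_sdiff.1 hy).2 hxB

theorem exists_submodule_codeSupport_eq {S T : Fin m → Finset F} {v j u : Fin m → ℕ}
    (hj : ∀ i, j i < (S i).card) (hT : ∀ i, T i ⊆ S i) (hu : ∀ i, 0 < u i)
    (hcard : ∀ i, (T i).card + j i + 1 = (S i).card + u i) (hv : ∀ i, v i + u i ≤ j i + 1) :
    ∃ W : Submodule F (Point S → F), W ≤ code S (L₁ j) ∧ W ⊓ code S (L₂ v j) = ⊥ ∧
      Module.finrank F W = ∏ i, u i ∧ codeSupport W = {p | ∀ i, (p i : F) ∈ T i} := by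
  classical
  set h : Fin m → Polynomial F := fun i => Lagrange.nodal (S i \ T i) id
  have hh : ∀ i, h i ≠ 0 := fun i => Lagrange.nodal_ne_zero
  have hdegree : ∀ i, (h i).natDegree + u i = j i + 1 := fun i => by
    have := Finset.card_sdiff_add_card_eq_card (hT i)
    have := hcard i
    simp only [h, Lagrange.natDegree_nodal]
    omega
  set E : Finset (Fin m → ℕ) := Fintype.piFinset fun i => Finset.range (u i)
  have hE : ∀ k, k ∈ E ↔ ∀ i, k i < u i := fun k => by simp [E]
  have hbox : ∀ k ∈ E, (k + fun i => (h i).natDegree) ∈ box v j := fun k hk => by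
    refine Finset.mem_Icc.2 ⟨fun i => ?_, fun i => ?_⟩ <;>
    · have := (hE k).1 hk i
      have := hdegree i
      have := hv i
      simp only [Pi.add_apply]
      omega
  have hboxΔ : box v j ⊆ delta S := (box_subset_L₁ v j).trans (L₁_subset_delta hj)
  refine ⟨multiples S E h, multiples_le_code fun k hk M hM => ?_,
    multiples_inf_code_eq_bot hh (fun k hk => ?_)
      (Finset.sdiff_subset.trans (L₁_subset_delta hj)), ?_, ?_⟩
  · refine Finset.mem_Icc.2 ⟨zero_le, fun i => ?_⟩
    have := (hE k).1 hk i
    have := hdegree i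
    have := hM i
    simp only [Pi.add_apply]
    omega
  · exact Finset.mem_sdiff.2 ⟨hboxΔ (hbox k hk), fun hmem =>
      (Finset.mem_sdiff.1 hmem).2 (hbox k hk)⟩
  · rw [finrank_multiples hh fun k hk => hboxΔ (hbox k hk), Fintype.card_piFinset]
    simp only [Finset.card_range]
  · rw [codeSupport_multiples ((hE 0).2 hu)]
    ext p
    exact forall_congr' fun i => eval_nodal_sdiff_ne_zero_iff (p i).2

theorem card_box (v j : Fin m → ℕ) : (box v j).card = ∏ i, (j i + 1 - v i) := by
  rw [box, Pi.card_Icc]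
  simp only [Nat.card_Icc]

theorem Considerate.isRelGenHammingWeight {S : Fin m → Finset F} {v j u : Fin m → ℕ} {c q : ℕ}
    (hcons : Considerate S v j) (hS : ∀ i, (S i).card = j i + c + 1) (hq : 0 < q)
    (hu : ∀ i, u i = q ∨ u i = q + 1) (huv : ∀ i, v i + u i ≤ j i + 1) :
    IsRelGenHammingWeight (code S (L₁ j)) (code S (L₂ v j)) (∏ i, u i) (∏ i, (c + u i)) := by
  have hj := fun i => (hcons.1 i).2
  have hu0 : ∀ i, 0 < u i := fun i => by rcases hu i with h | h <;> omega
  constructor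
  · choose T hT hTcard using fun i => Finset.exists_subset_card_eq
      (s := S i) (n := c + u i) (by have := hS i; have := huv i; omega)
    obtain ⟨W, hW₁, hW₂, hfinrank, hsupport⟩ := exists_submodule_codeSupport_eq hj hT hu0
      (fun i => by rw [hTcard, hS]; ring) huv
    refine ⟨W, hW₁, hW₂, hfinrank, ?_⟩
    rw [hsupport, ncard_setOf_forall_mem hT, Finset.prod_congr rfl fun i _ => hTcard i]
  · rintro _ ⟨W, hW₁, hW₂, hfinrank, rfl⟩
    obtain ⟨K, hK, hKcard, hKD⟩ := exists_subset_diamond_D_le hj hW₁ hW₂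
    have hle : ∏ i, u i ≤ (box v j).card := by
      rw [card_box]
      exact Finset.prod_le_prod' fun i _ => Nat.le_sub_of_add_le' (huv i)
    obtain ⟨K', hK', hK'card, hmin⟩ := hcons.2 _ (Finset.prod_pos fun i _ => hu0 i) hle
    calc ∏ i, (c + u i) ≤ (thicken c K').card := prod_add_le_card_thicken c hq hu hK'card
      _ ≤ D S K' := card_thicken_le_D S (fun i => by rw [hS]; exact Nat.lt_succ_self _)
        (hK'.trans (box_subset_L₁ v j))
      _ ≤ D S K := hmin K hK (hKcard.trans hfinrank)
      _ ≤ (codeSupport W).ncard := hKD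
end MonomialCartesian

namespace CosetScheme

variable {F ι : Type*} [Field F] {C₂ C₁ : Submodule F (ι → F)}

theorem encode_eq (P : CosetScheme C₂ C₁) (a : Fin P.k₂ → F) (x : Fin P.ℓ → F) :
    P.encode a x = (P.basis₁.equivFun.symm (Sum.elim a x) : C₁) := by
  simp [encode, Module.Basis.equivFun_symm_apply, Fintype.sum_sum_type]

theorem encode_zero_right (P : CosetScheme C₂ C₁) (a : Fin P.k₂ → F) :
    P.encode a 0 = P.basis₂.equivFun.symm a := by
  simp [encode, Module.Basis.equivFun_symm_apply, P.basis₁_inl]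

/-- The secret that is encoded in a word of `C₁`: its coordinates along the last `ℓ` members of
the basis of `C₁`. -/
noncomputable def decode (P : CosetScheme C₂ C₁) : C₁ →ₗ[F] (Fin P.ℓ → F) :=
  (LinearMap.funLeft F F Sum.inr).comp P.basis₁.equivFun.toLinearMap

theorem decode_equivFun_symm (P : CosetScheme C₂ C₁) (a : Fin P.k₂ → F) (x : Fin P.ℓ → F) :
    P.decode (P.basis₁.equivFun.symm (Sum.elim a x)) = x := by
  simp only [decode, LinearMap.comp_apply, LinearEquiv.coe_coe, LinearEquiv.apply_symm_apply]
  rfl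

theorem exists_encode_decode_eq (P : CosetScheme C₂ C₁) (c : C₁) :
    ∃ a, P.encode a (P.decode c) = (c : ι → F) := by
  refine ⟨fun i => P.basis₁.equivFun c (Sum.inl i), ?_⟩
  rw [encode_eq, Subtype.coe_inj, LinearEquiv.symm_apply_eq]
  ext (i | i) <;> rfl

theorem decode_eq_zero_iff (P : CosetScheme C₂ C₁) (c : C₁) :
    P.decode c = 0 ↔ (c : ι → F) ∈ C₂ := by
  constructor
  · intro hc
    obtain ⟨a, ha⟩ := P.exists_encode_decode_eq c
    rw [← ha, hc, encode_zero_right]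
    exact Subtype.coe_prop _
  · intro hc
    have hencode : P.encode (P.basis₂.equivFun ⟨c, hc⟩) 0 = (c : ι → F) := by
      rw [encode_zero_right, LinearEquiv.symm_apply_apply]
    rw [encode_eq] at hencode
    rw [← Subtype.ext hencode, decode_equivFun_symm]

/-- The secrets of the words that vanish on `A`. They form the direction of the affine space of
the secrets that are compatible with given shares of `A`. -/
noncomputable def hiddenSecrets (P : CosetScheme C₂ C₁) (A : Finset ι) :
    Submodule F (Fin P.ℓ → F) :=
  (Submodule.comap C₁.subtype
    (⨅ p ∈ A, LinearMap.ker (LinearMap.proj p : (ι → F) →ₗ[F] F))).map P.decode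

theorem mem_hiddenSecrets {P : CosetScheme C₂ C₁} {A : Finset ι} {x : Fin P.ℓ → F} :
    x ∈ P.hiddenSecrets A ↔ ∃ c : C₁, (∀ p ∈ A, (c : ι → F) p = 0) ∧ P.decode c = x := by
  simp [hiddenSecrets, Submodule.mem_map, Submodule.mem_iInf]

theorem mem_possibleSecrets_encode {P : CosetScheme C₂ C₁} {A : Finset ι} {a : Fin P.k₂ → F}
    {x y : Fin P.ℓ → F} :
    y ∈ P.possibleSecrets A (P.encode a x) ↔ y - x ∈ P.hiddenSecrets A := by
  rw [mem_hiddenSecrets, possibleSecrets, Set.mem_ofPred_eq]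
  set word := P.basis₁.equivFun.symm (Sum.elim a x)
  constructor
  · rintro ⟨b, hb⟩
    refine ⟨P.basis₁.equivFun.symm (Sum.elim b y) - word, fun p hp => ?_, ?_⟩
    · have hbp := hb p hp
      rw [encode_eq, encode_eq] at hbp
      simpa only [Submodule.coe_sub, Pi.sub_apply, sub_eq_zero] using hbp
    · rw [map_sub, decode_equivFun_symm, decode_equivFun_symm]
  · rintro ⟨c, hc, hcy⟩
    obtain ⟨b, hb⟩ := P.exists_encode_decode_eq (c + word)
    rw [map_add, decode_equivFun_symm, hcy, sub_add_cancel] at hb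
    refine ⟨b, fun p hp => ?_⟩
    rw [hb, encode_eq, Submodule.coe_add, Pi.add_apply, hc p hp, zero_add]

theorem ncard_possibleSecrets_encode [Fintype F] (P : CosetScheme C₂ C₁) (A : Finset ι)
    (a : Fin P.k₂ → F) (x : Fin P.ℓ → F) :
    (P.possibleSecrets A (P.encode a x)).ncard
      = Fintype.card F ^ Module.finrank F (P.hiddenSecrets A) := by
  have htranslate : P.possibleSecrets A (P.encode a x)
      = (· + x) '' (P.hiddenSecrets A : Set (Fin P.ℓ → F)) := by
    ext y
    simp [mem_possibleSecrets_encode, sub_eq_add_neg]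
  rw [htranslate, Set.ncard_image_of_injective _ (add_left_injective x), ← Nat.card_coe_set_eq,
    ← Nat.card_eq_fintype_card (α := F)]
  exact Module.natCard_eq_pow_finrank (K := F)

theorem information_encode [Fintype F] (P : CosetScheme C₂ C₁) (A : Finset ι)
    (a : Fin P.k₂ → F) (x : Fin P.ℓ → F) :
    P.information A (P.encode a x) = P.ℓ - Module.finrank F (P.hiddenSecrets A) := by
  have hq : (1 : ℝ) < Fintype.card F := by exact_mod_cast Fintype.one_lt_card
  rw [information, ncard_possibleSecrets_encode, Nat.cast_pow, Real.logb_pow,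
    Real.logb_self_eq_one hq, mul_one]

theorem canRecover_iff [Fintype F] {P : CosetScheme C₂ C₁} {A : Finset ι} {i : ℕ} :
    P.CanRecover A i ↔ i + Module.finrank F (P.hiddenSecrets A) ≤ P.ℓ := by
  simp only [CanRecover, information_encode, forall_const, le_sub_iff_add_le]
  norm_cast

theorem nonQualifying_sub_add_one_iff [Fintype F] {P : CosetScheme C₂ C₁} {A : Finset ι} {e : ℕ}
    (he : e ≤ P.ℓ) :
    P.NonQualifying (P.ℓ - e + 1) A ↔ e ≤ Module.finrank F (P.hiddenSecrets A) := by
  rw [NonQualifying, canRecover_iff]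
  omega

theorem finrank_le_finrank_hiddenSecrets (P : CosetScheme C₂ C₁) {A : Finset ι}
    {W : Submodule F (ι → F)} (hW₁ : W ≤ C₁) (hW₂ : W ⊓ C₂ = ⊥)
    (hA : ∀ c ∈ W, ∀ p ∈ A, c p = 0) :
    Module.finrank F W ≤ Module.finrank F (P.hiddenSecrets A) := by
  let f : W →ₗ[F] P.hiddenSecrets A :=
    (P.decode.comp (Submodule.inclusion hW₁)).codRestrict _ fun c =>
      mem_hiddenSecrets.2 ⟨_, hA c c.2, rfl⟩
  refine LinearMap.finrank_le_finrank_of_injective (f := f) ?_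
  rw [← LinearMap.ker_eq_bot, LinearMap.ker_eq_bot']
  intro c hc
  have hcC₂ : (c : ι → F) ∈ C₂ := (P.decode_eq_zero_iff _).1 (congrArg Subtype.val hc)
  exact Subtype.ext ((Submodule.mem_bot F).1 (hW₂.le ⟨c.2, hcC₂⟩))

theorem exists_submodule_of_le_finrank_hiddenSecrets (P : CosetScheme C₂ C₁) {A : Finset ι}
    {e : ℕ} (he : e ≤ Module.finrank F (P.hiddenSecrets A)) :
    ∃ W : Submodule F (ι → F), W ≤ C₁ ∧ W ⊓ C₂ = ⊥ ∧ Module.finrank F W = e ∧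
      ∀ c ∈ W, ∀ p ∈ A, c p = 0 := by
  obtain ⟨b, hb⟩ := exists_linearIndependent_of_le_finrank he
  choose w hwA hw using fun i => mem_hiddenSecrets.1 (b i).2
  have hdecode : LinearIndependent F fun i => P.decode (w i) := by
    simp only [hw]
    exact hb.map' (P.hiddenSecrets A).subtype (Submodule.ker_subtype _)
  have hindep : LinearIndependent F fun i => (w i : ι → F) :=
    (LinearIndependent.of_comp P.decode hdecode).map' C₁.subtype (Submodule.ker_subtype _)
  refine ⟨Submodule.span F (Set.range fun i => (w i : ι → F)), ?_, ?_, ?_, ?_⟩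
  · rw [Submodule.span_le]
    rintro _ ⟨i, rfl⟩
    exact (w i).2
  · rw [Submodule.eq_bot_iff]
    rintro c ⟨hc, hcC₂⟩
    obtain ⟨t, rfl⟩ := (Submodule.mem_span_range_iff_exists_fun F).1 hc
    have hsum : P.decode (∑ i, t i • w i) = 0 := by
      rw [decode_eq_zero_iff]
      simpa using hcC₂
    simp only [map_sum, map_smul] at hsum
    have ht := Fintype.linearIndependent_iff.1 hdecode t hsum
    simp only [ht, zero_smul, Finset.sum_const_zero]
  · rw [finrank_span_eq_card hindep, Fintype.card_fin]
  · intro c hc p hp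
    obtain ⟨t, rfl⟩ := (Submodule.mem_span_range_iff_exists_fun F).1 hc
    simp [hwA _ p hp]

theorem finrank_eq_finrank_add (P : CosetScheme C₂ C₁) :
    Module.finrank F C₁ = Module.finrank F C₂ + P.ℓ := by
  rw [Module.finrank_eq_card_basis P.basis₁, Module.finrank_eq_card_basis P.basis₂]
  simp

end CosetScheme

namespace IsRelGenHammingWeight

open CosetScheme

variable {F ι : Type*} [Field F] {C₂ C₁ : Submodule F (ι → F)} {e w : ℕ}

theorem le_secretLength (h : IsRelGenHammingWeight C₁ C₂ e w) (P : CosetScheme C₂ C₁) :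
    e ≤ P.ℓ := by
  obtain ⟨⟨W, hW₁, hW₂, rfl, -⟩, -⟩ := h
  refine (P.finrank_le_finrank_hiddenSecrets (A := ∅) hW₁ hW₂ (by simp)).trans ?_
  simpa using Submodule.finrank_le (P.hiddenSecrets ∅)

variable [Fintype F] [Fintype ι]

theorem card_add_le_of_nonQualifying (h : IsRelGenHammingWeight C₁ C₂ e w)
    {P : CosetScheme C₂ C₁} {B : Finset ι} (hB : P.NonQualifying (P.ℓ - e + 1) B) :
    B.card + w ≤ Fintype.card ι := by
  classical
  obtain ⟨W, hW₁, hW₂, hWe, hWB⟩ := P.exists_submodule_of_le_finrank_hiddenSecrets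
    ((nonQualifying_sub_add_one_iff (h.le_secretLength P)).1 hB)
  have hsupport : codeSupport W ⊆ ((Bᶜ : Finset ι) : Set ι) := by
    rintro p ⟨c, hc, hcp⟩
    rw [Finset.mem_coe, Finset.mem_compl]
    exact fun hp => hcp (hWB c hc p hp)
  have hcard : w ≤ Bᶜ.card := by
    rw [← Set.ncard_coe_finset]
    exact (h.2 ⟨W, hW₁, hW₂, hWe, rfl⟩).trans (Set.ncard_le_ncard hsupport)
  rw [← Finset.card_add_card_compl B]
  exact Nat.add_le_add_left hcard _

theorem isReconstructionNumber (h : IsRelGenHammingWeight C₁ C₂ e w) (P : CosetScheme C₂ C₁) :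
    P.IsReconstructionNumber (P.ℓ - e + 1) (Fintype.card ι - w + 1) := by
  classical
  constructor
  · intro A hA
    by_contra hnq
    have := h.card_add_le_of_nonQualifying hnq
    omega
  · intro r hr
    obtain ⟨W, hW₁, hW₂, hWe, hWw⟩ := h.1
    by_contra! hlt
    have hrA : r ≤ (codeSupport W).toFinsetᶜ.card := by
      rw [Finset.card_compl, ← Set.ncard_eq_toFinset_card', hWw]
      omega
    obtain ⟨A, hA, hAr⟩ := Finset.exists_subset_card_eq hrA
    refine (nonQualifying_sub_add_one_iff (h.le_secretLength P)).2 ?_ (hr A hAr)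
    refine hWe.ge.trans (P.finrank_le_finrank_hiddenSecrets hW₁ hW₂ fun c hc p hp => ?_)
    by_contra hcp
    exact Finset.mem_compl.1 (hA hp) (Set.mem_toFinset.2 ⟨c, hc, hcp⟩)

theorem maximumNonQualifying (h : IsRelGenHammingWeight C₁ C₂ e w) {P : CosetScheme C₂ C₁}
    {A : Finset ι} (he : e ≤ Module.finrank F (P.hiddenSecrets A))
    (hA : A.card + w = Fintype.card ι) : P.MaximumNonQualifying (P.ℓ - e + 1) A := by
  refine ⟨(nonQualifying_sub_add_one_iff (h.le_secretLength P)).2 he, fun B hB => ?_⟩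
  have := h.card_add_le_of_nonQualifying hB
  omega

end IsRelGenHammingWeight

namespace MonomialCartesian

variable {m : ℕ} {F : Type*} [Field F]

theorem secretLength_eq {S : Fin m → Finset F} {v j : Fin m → ℕ} (hvj : ∀ i, v i ≤ j i)
    (hj : ∀ i, j i < (S i).card) (P : CosetScheme (code S (L₂ v j)) (code S (L₁ j))) :
    P.ℓ = ∏ i, (j i - v i + 1) := by
  have hrank := P.finrank_eq_finrank_add
  have hL₂ : L₂ v j ⊆ L₁ j := Finset.sdiff_subset
  have hcard : (L₂ v j).card + (box v j).card = (L₁ j).card :=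
    Finset.card_sdiff_add_card_eq_card (box_subset_L₁ v j)
  rw [finrank_code (L₁_subset_delta hj), finrank_code (hL₂.trans (L₁_subset_delta hj))] at hrank
  rw [Finset.prod_congr rfl fun i _ => (Nat.sub_add_comm (hvj i)).symm, ← card_box]
  omega

theorem prod_le_finrank_hiddenSecrets_removeProduct {S T : Fin m → Finset F} {v j u : Fin m → ℕ}
    (hj : ∀ i, j i < (S i).card) (hT : ∀ i, T i ⊆ S i) (hu : ∀ i, 0 < u i)
    (hcard : ∀ i, (T i).card + j i + 1 = (S i).card + u i) (hv : ∀ i, v i + u i ≤ j i + 1)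
    (P : CosetScheme (code S (L₂ v j)) (code S (L₁ j))) :
    ∏ i, u i ≤ Module.finrank F (P.hiddenSecrets (removeProduct S T)) := by
  classical
  obtain ⟨W, hW₁, hW₂, hfinrank, hsupport⟩ := exists_submodule_codeSupport_eq hj hT hu hcard hv
  refine hfinrank.ge.trans (P.finrank_le_finrank_hiddenSecrets hW₁ hW₂ fun c hc p hp => ?_)
  by_contra hcp
  exact (Finset.mem_filter.1 hp).2 (hsupport.le ⟨c, hc, hcp⟩)

section TwoValues

variable {a b : ℕ} {I : Finset (Fin m)}

theorem prod_eq_pow_mul_pow (hab : a + b = m) (hI : I.card = a) {f : Fin m → ℕ} {x y : ℕ}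
    (hx : ∀ i ∈ I, f i = x) (hy : ∀ i ∉ I, f i = y) : ∏ i, f i = x ^ a * y ^ b := by
  have hIc : Iᶜ.card = b := by
    rw [Finset.card_compl, Fintype.card_fin, hI]
    omega
  rw [← Finset.prod_mul_prod_compl I, Finset.prod_congr rfl hx,
    Finset.prod_congr rfl fun i hi => hy i (Finset.mem_compl.1 hi), Finset.prod_const,
    Finset.prod_const, hI, hIc]

theorem pos_of_notMem (hab : a + b = m) (hI : I.card = a) {i : Fin m} (hi : i ∉ I) : 0 < b := by
  have := Finset.card_lt_univ_of_notMem hi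
  rw [Fintype.card_fin] at this
  omega

end TwoValues

theorem Considerate.isRelGenHammingWeight_pow_mul_pow {S : Fin m → Finset F} {v j : Fin m → ℕ}
    {c : ℕ} (hcons : Considerate S v j) (hS : ∀ i, (S i).card = j i + c + 1) {a b z : ℕ}
    (hab : a + b = m) (hz : ∀ i, v i + z ≤ j i + 1) (hz₁ : 1 ≤ z) (hz₂ : 0 < b → 2 ≤ z) :
    IsRelGenHammingWeight (code S (L₁ j)) (code S (L₂ v j)) (z ^ a * (z - 1) ^ b)
      ((c + z) ^ a * (c + (z - 1)) ^ b) := by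
  obtain ⟨I, -, hI⟩ := Finset.exists_subset_card_eq (s := (Finset.univ : Finset (Fin m))) (n := a)
    (by rw [Finset.card_univ, Fintype.card_fin]; omega)
  obtain ⟨u, hu₁, hu₂⟩ : ∃ u : Fin m → ℕ, (∀ i ∈ I, u i = z) ∧ ∀ i ∉ I, u i = z - 1 :=
    ⟨fun i => if i ∈ I then z else z - 1, fun i hi => if_pos hi, fun i hi => if_neg hi⟩
  have hu : ∀ i, u i = max 1 (z - 1) ∨ u i = max 1 (z - 1) + 1 := fun i => by
    by_cases hi : i ∈ I
    · rw [hu₁ i hi]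
      omega
    · rw [hu₂ i hi]
      have := hz₂ (pos_of_notMem hab hI hi)
      omega
  have huv : ∀ i, v i + u i ≤ j i + 1 := fun i => by
    have := hz i
    by_cases hi : i ∈ I
    · rwa [hu₁ i hi]
    · rw [hu₂ i hi]
      omega
  have hweight := hcons.isRelGenHammingWeight hS (by omega) hu huv
  rwa [prod_eq_pow_mul_pow hab hI hu₁ hu₂, prod_eq_pow_mul_pow hab hI
    (fun i hi => congrArg (c + ·) (hu₁ i hi)) fun i hi => congrArg (c + ·) (hu₂ i hi)] at hweight

theorem pow_mul_pow_le_finrank_hiddenSecrets_removeProduct {S T : Fin m → Finset F}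
    {v j : Fin m → ℕ} {c : ℕ} (hS : ∀ i, (S i).card = j i + c + 1) (hT : ∀ i, T i ⊆ S i)
    {a b z : ℕ} (hab : a + b = m) (hz : ∀ i, v i + z ≤ j i + 1) (hz₁ : 1 ≤ z)
    (hz₂ : 0 < b → 2 ≤ z) {I : Finset (Fin m)} (hI : I.card = a)
    (hT₁ : ∀ i ∈ I, (T i).card = c + z) (hT₂ : ∀ i ∉ I, (T i).card = c + (z - 1))
    (P : CosetScheme (code S (L₂ v j)) (code S (L₁ j))) :
    z ^ a * (z - 1) ^ b ≤ Module.finrank F (P.hiddenSecrets (removeProduct S T)) := by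
  have hcard : ∀ i, c < (T i).card ∧ (T i).card ≤ c + z := fun i => by
    by_cases hi : i ∈ I
    · rw [hT₁ i hi]
      omega
    · rw [hT₂ i hi]
      have := hz₂ (pos_of_notMem hab hI hi)
      omega
  rw [← prod_eq_pow_mul_pow hab hI (f := fun i => (T i).card - c)
    (fun i hi => by rw [hT₁ i hi, Nat.add_sub_cancel_left])
    (fun i hi => by rw [hT₂ i hi, Nat.add_sub_cancel_left])]
  refine prod_le_finrank_hiddenSecrets_removeProduct (fun i => ?_) hT (fun i => ?_) (fun i => ?_)
    (fun i => ?_) P <;>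
  · have := hS i
    have := hcard i
    have := hz i
    omega

end MonomialCartesian

open MonomialCartesian in
theorem mainTheorem4_general {F : Type*} [Field F] [Fintype F] {m c : ℕ} {S : Fin m → Finset F}
    {v j : Fin m → ℕ} (hS : ∀ i, (S i).card = j i + c + 1) (hcons : Considerate S v j)
    (P : CosetScheme (code S (L₂ v j)) (code S (L₁ j))) {a b z : ℕ} (hab : a + b = m)
    (hz : ∀ i, v i + z ≤ j i + 1) (hz₁ : 1 ≤ z) (hz₂ : 0 < b → 2 ≤ z) :
    Fintype.card (Point S) = ∏ i, (S i).card ∧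
    P.ℓ = ∏ i, (j i - v i + 1) ∧
    IsRelGenHammingWeight (code S (L₁ j)) (code S (L₂ v j)) (z ^ a * (z - 1) ^ b)
      ((c + z) ^ a * (c + (z - 1)) ^ b) ∧
    P.IsReconstructionNumber (P.ℓ - z ^ a * (z - 1) ^ b + 1)
      (∏ i, (S i).card - (c + z) ^ a * (c + (z - 1)) ^ b + 1) ∧
    ∀ T : Fin m → Finset F, (∀ i, T i ⊆ S i) →
      (∃ I : Finset (Fin m), I.card = a ∧
        (∀ i ∈ I, (T i).card = c + z) ∧ (∀ i ∉ I, (T i).card = c + (z - 1))) →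
      (∀ (r : Fin P.k₂ → F) (x : Fin P.ℓ → F), P.information (removeProduct S T) (P.encode r x) ≤
        (P.ℓ : ℝ) - (z ^ a * (z - 1) ^ b : ℕ)) ∧
      P.MaximumNonQualifying (P.ℓ - z ^ a * (z - 1) ^ b + 1) (removeProduct S T) := by
  have hpoint : Fintype.card (Point S) = ∏ i, (S i).card := by simp
  have hweight := hcons.isRelGenHammingWeight_pow_mul_pow hS hab hz hz₁ hz₂
  have hℓ := secretLength_eq (fun i => (hcons.1 i).1.le) (fun i => (hcons.1 i).2) P
  refine ⟨hpoint, hℓ, hweight, hpoint ▸ hweight.isReconstructionNumber P, ?_⟩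
  rintro T hT ⟨I, hI, hT₁, hT₂⟩
  have hhidden := pow_mul_pow_le_finrank_hiddenSecrets_removeProduct hS hT hab hz hz₁ hz₂ hI
    hT₁ hT₂ P
  refine ⟨fun r x => ?_, hweight.maximumNonQualifying hhidden ?_⟩
  · rw [P.information_encode]
    exact sub_le_sub_left (Nat.cast_le.2 hhidden) _
  · rw [← prod_eq_pow_mul_pow hab hI hT₁ hT₂, card_removeProduct_add hT]

theorem mainTheorem4 {F : Type*} [Field F] [Fintype F] (m : ℕ) (hm : 2 ≤ m)
    (S : Fin m → Finset F) (s v j : ℕ) (hs : ∀ i, (S i).card = s)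
    (hcons : MonomialCartesian.Considerate S (fun _ => v) (fun _ => j))
    (P : CosetScheme (MonomialCartesian.code S (MonomialCartesian.L₂ (fun _ => v) (fun _ => j)))
      (MonomialCartesian.code S (MonomialCartesian.L₁ (fun _ => j))))
    (a b z e : ℕ) (hab : a + b = m) (he : e = z ^ a * (z - 1) ^ b)
    (hz : z ≤ j - v + 1) (hz1 : b = 0 → 1 ≤ z) (hz2 : 0 < b → 2 ≤ z) :
    Fintype.card (MonomialCartesian.Point S) = s ^ m ∧
    P.ℓ = (j - v + 1) ^ m ∧
    IsRelGenHammingWeight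
      (MonomialCartesian.code S (MonomialCartesian.L₁ (fun _ => j)))
      (MonomialCartesian.code S (MonomialCartesian.L₂ (fun _ => v) (fun _ => j)))
      e ((s + z - j - 1) ^ a * (s + z - j - 2) ^ b) ∧
    P.IsReconstructionNumber (P.ℓ - e + 1)
      (s ^ m - (s + z - j - 1) ^ a * (s + z - j - 2) ^ b + 1) ∧
    ∀ T : Fin m → Finset F, (∀ i, T i ⊆ S i) →
      (∃ I : Finset (Fin m), I.card = a ∧
        (∀ i ∈ I, (T i).card = s + z - j - 1) ∧ (∀ i ∉ I, (T i).card = s + z - j - 2)) →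
      (∀ (r : Fin P.k₂ → F) (x : Fin P.ℓ → F),
        P.information (MonomialCartesian.removeProduct S T) (P.encode r x) ≤ (P.ℓ : ℝ) - e) ∧
      P.MaximumNonQualifying (P.ℓ - e + 1) (MonomialCartesian.removeProduct S T) := by
  subst he
  have hvj : v < j := (hcons.1 ⟨0, by omega⟩).1
  have hvz : v + z ≤ j + 1 := by omega
  obtain ⟨c, rfl⟩ := Nat.exists_eq_add_of_lt (hs ⟨0, by omega⟩ ▸ (hcons.1 ⟨0, by omega⟩).2)
  rw [show j + c + 1 + z - j - 1 = c + z by omega,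
    show j + c + 1 + z - j - 2 = c + (z - 1) by omega]
  simpa [hs] using mainTheorem4_general hs hcons P hab (fun _ => hvz) (by omega) hz2
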